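/- Let $D=D([0,\infty),\mathbb R)$ be the space of right-continuous real-valued functions on $[0,\infty)$ with limits from the left, endowed with Skorokhod's $J_1$ topology, let $D^m=D\times\cdots\times D$ ($m$ factors) carry the product topology, and let all these spaces carry their Borel $\sigma$-fields. Let $k\ge 0$ be an integer. Suppose that (i) for each $n\ge 1$, $X_n$ is a random element of $D^k$ and $M_n$ is a random element of $D$, defined on a common probability space $(\Omega_n,\mathcal F_n,P_n)$ that may depend on $n$; and $X$ is a random element of $D^k$ and $M$ a random element of $D$, defined on a common probability space $(\Omega,\mathcal F,P)$; (ii) for each $n\ge 1$, $M_n$ is a martingale with respect to the filtration generated by $(X_n,M_n)$, i.e. $\mathcal F_{n,t}=\sigma\big((X_n(s),M_n(s)):0\le s\le t\big)$, $t\ge 0$; (iii) $(X_n,M_n)\Rightarrow (X,M)$ in $D^{k+1}$ as $n\to\infty$, where $\Rightarrow$ denotes convergence in distribution; (iv) for each $t>0$, the sequence $\{M_n(t):n\ge 1\}$ is uniformly integrable, i.e. $\lim_{K\to\infty}\sup_{n\ge1}E\big[|M_n(t)|\,\mathbf 1_{\{|M_n(t)|\ge K\}}\big]=0$. Then $M$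 is a martingale with respect to the filtration generated by $(X,M)$, i.e. $\mathcal F_t=\sigma\big((X(s),M(s)):0\le s\le t\big)$, $t\ge 0$, and thus also with respect to the filtration generated by $M$, i.e. $\sigma\big(M(s):0\le s\le t\big)$, $t\ge 0$. -/

import Mathlib

open MeasureTheory ProbabilityTheory Filter Topology
open scoped NNReal ENNReal

namespace Skorokhod

/-- The space `D = D([0,∞), ℝ)` of right-continuous real functions on `[0,∞)` with limits from the
left. (At `t = 0` the second condition is void, since `𝓝[<] (0 : ℝ≥0) = ⊥`.) -/
structure D where
  /-- the underlying function -/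
  toFun : ℝ≥0 → ℝ
  right_cont : ∀ t, ContinuousWithinAt toFun (Set.Ici t) t
  left_lim : ∀ t, ∃ l, Tendsto toFun (𝓝[<] t) (𝓝 l)

instance : CoeFun D (fun _ => ℝ≥0 → ℝ) := ⟨D.toFun⟩

/-- The basic `J₁`-neighbourhood of `x`: all `y` for which some increasing bijection `lam` of
`[0,∞)` onto itself (a time change) satisfies `|lam s - s| < ε` for all `s ≥ 0` and
`|y (lam s) - x s| < ε` for all `s ≤ T`. -/
def nbhd (x : D) (T : ℝ≥0) (ε : ℝ) : Set D :=
  {y | ∃ lam : ℝ≥0 ≃o ℝ≥0, (∀ s, |(lam s : ℝ) - s| < ε) ∧ ∀ s ≤ T, |y (lam s) - x s| < ε}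

lemma nbhd_mono (x : D) {T T' : ℝ≥0} {ε ε' : ℝ} (hT : T ≤ T') (hε : ε' ≤ ε) :
    nbhd x T' ε' ⊆ nbhd x T ε := by
  rintro y ⟨lam, h1, h2⟩
  exact ⟨lam, fun s => (h1 s).trans_le hε, fun s hs => (h2 s (hs.trans hT)).trans_le hε⟩

/-- Skorokhod's `J₁` topology on `D`: the topology in which the sets `nbhd x T ε` (`T ≥ 0`,
`ε > 0`) form a neighbourhood basis at `x`. A sequence `x n` converges to `x` in it if and only if
there are time changes `lam n` with `sup_{s ≥ 0} |lam n s - s| → 0` and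
`sup_{s ≤ T} |x n (lam n s) - x s| → 0` for every `T`. -/
instance : TopologicalSpace D where
  IsOpen U := ∀ x ∈ U, ∃ T : ℝ≥0, ∃ ε : ℝ, 0 < ε ∧ nbhd x T ε ⊆ U
  isOpen_univ := fun _ _ => ⟨0, 1, one_pos, Set.subset_univ _⟩
  isOpen_inter := by
    rintro U V hU hV x ⟨hxU, hxV⟩
    obtain ⟨T, ε, hε, h⟩ := hU x hxU
    obtain ⟨T', ε', hε', h'⟩ := hV x hxV
    exact ⟨max T T', min ε ε', lt_min hε hε', Set.subset_inter
      ((nbhd_mono x (le_max_left _ _) (min_le_left _ _)).trans h)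
      ((nbhd_mono x (le_max_right _ _) (min_le_right _ _)).trans h')⟩
  isOpen_sUnion := by
    rintro S hS x ⟨U, hU, hxU⟩
    obtain ⟨T, ε, hε, h⟩ := hS U hU x hxU
    exact ⟨T, ε, hε, h.trans (Set.subset_sUnion_of_mem hU)⟩

/-- `D` carries its Borel σ-algebra. -/
instance : MeasurableSpace D := borel D

instance : BorelSpace D := ⟨rfl⟩

/-- The product space `D^m = D × ⋯ × D` with the product topology and its Borel σ-algebra. -/
def Dpow (m : ℕ) : Type := Fin m → D

instance (m : ℕ) : TopologicalSpace (Dpow m) := inferInstanceAs (TopologicalSpace (Fin m → D))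

instance (m : ℕ) : MeasurableSpace (Dpow m) := borel (Dpow m)

instance (m : ℕ) : BorelSpace (Dpow m) := ⟨rfl⟩

/-- The pair `(x, y)` in `D^{k+1}` of `x` in `D^k` and `y` in `D`. -/
def Dpow.snoc {k : ℕ} (x : Dpow k) (y : D) : Dpow (k + 1) := Fin.snoc (α := fun _ => D) x y

lemma measurable_proj {m : ℕ} (i : Fin m) : Measurable (fun x : Dpow m => x i) :=
  (show Continuous (fun x : Fin m → D => x i) from continuous_apply i).borel_measurable

/-- The set of paths that go below `a` somewhere in `(t, u)` is `J₁`-open. -/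
lemma isOpen_exists_lt (t u : ℝ≥0) (a : ℝ) : IsOpen {x : D | ∃ s, t < s ∧ s < u ∧ x s < a} := by
  rintro x ⟨s, hts, hsu, hxs⟩
  have h1 : (t : ℝ) < s := by exact_mod_cast hts
  have h2 : (s : ℝ) < u := by exact_mod_cast hsu
  refine ⟨s, min (min ((s : ℝ) - t) (u - s)) (a - x s),
    lt_min (lt_min (by linarith) (by linarith)) (by linarith), ?_⟩
  rintro y ⟨lam, hl, hy⟩
  have h3 := abs_lt.1 ((hl s).trans_le ((min_le_left _ _).trans (min_le_left _ _)))
  have h4 := abs_lt.1 ((hl s).trans_le ((min_le_left _ _).trans (min_le_right _ _)))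
  have h5 := abs_lt.1 ((hy s le_rfl).trans_le (min_le_right _ _))
  refine ⟨lam s, ?_, ?_, by linarith [h5.2]⟩
  · rw [← NNReal.coe_lt_coe]; linarith [h3.1]
  · rw [← NNReal.coe_lt_coe]; linarith [h4.2]

/-- The coordinate projections of `D` are Borel measurable. -/
lemma measurable_eval (t : ℝ≥0) : Measurable (fun x : D => x t) := by
  refine measurable_of_Ioi fun a => ?_
  have key : (fun x : D => x t) ⁻¹' Set.Ioi a =
      ⋃ n : ℕ, {x : D | ∃ s, t < s ∧ s < t + 1 / ((n : ℝ≥0) + 1) ∧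
        x s < a + 1 / ((n : ℝ) + 1)}ᶜ := by
    ext x
    simp only [Set.mem_preimage, Set.mem_Ioi, Set.mem_iUnion, Set.mem_compl_iff, Set.mem_ofPred_eq,
      not_exists, not_and, not_lt]
    have hlim : Tendsto x (𝓝[>] t) (𝓝 (x t)) :=
      (x.right_cont t).mono_left (nhdsWithin_mono t Set.Ioi_subset_Ici_self)
    constructor
    · intro hx
      obtain ⟨b, hab, hbx⟩ := exists_between hx
      have hev := hlim.eventually (lt_mem_nhds hbx)
      obtain ⟨u, htu, hu⟩ := (mem_nhdsGT_iff_exists_Ioo_subset' (lt_add_one t)).1 hev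
      obtain ⟨n₁, hn₁⟩ := exists_nat_one_div_lt (sub_pos.2 hab)
      obtain ⟨n₂, hn₂⟩ := exists_nat_one_div_lt (tsub_pos_of_lt (show t < u from htu))
      refine ⟨max n₁ n₂, fun s hts hs => ?_⟩
      have e1 : 1 / (((max n₁ n₂ : ℕ) : ℝ) + 1) ≤ 1 / ((n₁ : ℝ) + 1) :=
        Nat.one_div_le_one_div (le_max_left _ _)
      have e2 : 1 / (((max n₁ n₂ : ℕ) : ℝ≥0) + 1) ≤ 1 / ((n₂ : ℝ≥0) + 1) :=
        Nat.one_div_le_one_div (le_max_right _ _)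
      have hsu : s < u := hs.trans_le ((add_le_add_right (e2.trans hn₂.le) t).trans
        (add_tsub_cancel_of_le (le_of_lt htu)).le)
      have hbs : b < x s := hu ⟨hts, hsu⟩
      linarith
    · rintro ⟨n, hn⟩
      have hpos : (0 : ℝ) < 1 / ((n : ℝ) + 1) := by positivity
      have hpos' : (0 : ℝ≥0) < 1 / ((n : ℝ≥0) + 1) := by positivity
      have hge : a + 1 / ((n : ℝ) + 1) ≤ x t := by
        refine ge_of_tendsto hlim ?_
        filter_upwards [Ioo_mem_nhdsGT (lt_add_of_pos_right t hpos')] with s hs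
        exact hn s hs.1 hs.2
      linarith
  rw [key]
  exact MeasurableSet.iUnion fun n => (isOpen_exists_lt _ _ _).measurableSet.compl

section Filtrations

variable {Ω : Type*} [mΩ : MeasurableSpace Ω]

/-- The filtration generated by a random element `M` of `D`: at time `t` it is
`σ(M(s) : s ≤ t)`. -/
noncomputable def filtrationOf (M : Ω → D) (hM : Measurable M) :
    Filtration ℝ≥0 mΩ :=
  Filtration.natural (fun t ω => M ω t)
    (fun t => ((measurable_eval t).comp hM).stronglyMeasurable)

/-- The filtration generated by `(X, M)`, for random elements `X` of `D^k` and `M` of `D`: at time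
`t` it is `σ(X₁(s), …, X_k(s), M(s) : s ≤ t)`. -/
noncomputable def filtrationOfPair {k : ℕ} (X : Ω → Dpow k) (M : Ω → D)
    (hX : Measurable X) (hM : Measurable M) :
    Filtration ℝ≥0 mΩ :=
  Filtration.natural (fun t ω => ((fun i => X ω i t : Fin k → ℝ), M ω t))
    (fun t => ((measurable_pi_lambda _ fun i =>
      (measurable_eval t).comp ((measurable_proj i).comp hX)).prodMk
        ((measurable_eval t).comp hM)).stronglyMeasurable)

end Filtrations

/-- Uniform integrability of a family of real random variables, each on its own probability space:
`sup_i E[|f i| ; |f i| ≥ K] → 0` as `K → ∞`. -/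
def UnifInt {ι : Type*} {Ω : ι → Type*} [∀ i, MeasurableSpace (Ω i)]
    (P : ∀ i, Measure (Ω i)) (f : ∀ i, Ω i → ℝ) : Prop :=
  Tendsto (fun K : ℝ => ⨆ i, ∫⁻ ω in {ω | K ≤ |f i ω|}, ENNReal.ofReal |f i ω| ∂(P i))
    atTop (𝓝 0)

end Skorokhod

/-! Evaluation at a fixed time is not `J₁`-continuous, so the martingale identity cannot be passed
to the limit directly. The average of a path over `[a, a + h]` with `h > 0` is `J₁`-continuous, and
by right-continuity it tends to the value at `a` as `h → 0`. Averages over `D^{k+1}` are taken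
coordinate by coordinate, so the product topology suffices.

Fix `s ≤ t`, `h > 0`, and let `Z_n` be a bounded continuous function of averages of `(X_n, M_n)`
over finitely many intervals `[τ_j, τ_j + h]` with `τ_j ≤ s`. Then `Z_n` is known at time `s + h`,
and Fubini with the martingale property shows that the averages of `M_n` over `[t + h, t + 2h]` and
over `[s + h, s + 2h]` both integrate against `Z_n` to `E[M_n(s + h) Z_n]` (`integral_avg_mul`). The
identity survives `n → ∞` (`limit_avg`) and then `h → 0` (`integral_mul_eq_of_limit`). Finally,
finite-dimensional marginals determine a finite measure on a product, which turns the identity for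
test functions into one for all events of the past (`setIntegral_eq_zero_of_forall_finset`).

Both limits need uniform integrability. It is carried by the excess `E(|·| - K)⁺`: by convexity, the
excess of `M_n(T)` bounds those of `M_n(u)`, `u ≤ T`, and of their averages. The bound is uniform in
`n` and `h` and passes to the limit in distribution (`tendsto_integral_mul_of_uniformIntegrable`).
-/

namespace Skorokhod

/-! ### Regularity of càdlàg paths and continuity of their averages -/

open unitInterval

/-- A path of `D` is bounded on bounded intervals. -/
lemma D.exists_bound (x : D) (T : ℝ≥0) : ∃ C, ∀ s ≤ T, |x s| ≤ C := by
  have key : ∃ C, ∀ s ∈ Set.Icc 0 T, |x s| ≤ C := by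
    refine (isCompact_Icc (a := (0 : ℝ≥0)) (b := T)).induction_on
      (p := fun S => ∃ C, ∀ s ∈ S, |x s| ≤ C) ⟨0, by simp⟩ ?_ ?_ ?_
    · rintro S S' hS ⟨C, hC⟩
      exact ⟨C, fun s hs => hC s (hS hs)⟩
    · rintro S S' ⟨C, hC⟩ ⟨C', hC'⟩
      refine ⟨max C C', fun s hs => ?_⟩
      rcases hs with hs | hs
      · exact (hC s hs).trans (le_max_left _ _)
      · exact (hC' s hs).trans (le_max_right _ _)
    · intro t _
      obtain ⟨l, hl⟩ := x.left_lim t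
      have h1 : ∀ᶠ s in 𝓝[<] t, |x s| < |l| + 1 := hl.abs.eventually (gt_mem_nhds (by simp))
      have h2 : ∀ᶠ s in 𝓝[≥] t, |x s| < |x t| + 1 :=
        (x.right_cont t).tendsto.abs.eventually (gt_mem_nhds (by simp))
      refine ⟨{s | |x s| ≤ max (|l| + 1) (|x t| + 1)}, mem_nhdsWithin_of_mem_nhds ?_,
        _, fun s hs => hs⟩
      rw [← nhdsLT_sup_nhdsGE, mem_sup]
      exact ⟨h1.mono fun s hs => hs.le.trans (le_max_left _ _),
        h2.mono fun s hs => hs.le.trans (le_max_right _ _)⟩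
  obtain ⟨C, hC⟩ := key
  exact ⟨C, fun s hs => hC s ⟨zero_le, hs⟩⟩

/-- Just to the left of such a `t` the values lie below `q`, so no other point of the set is there:
every point is isolated from the left within the set, and such a set is countable. -/
lemma countable_upcrossing (f : ℝ≥0 → ℝ) (q : ℝ) :
    {t | q < f t ∧ ∀ᶠ s in 𝓝[<] t, f s < q}.Countable := by
  set S := {t | q < f t ∧ ∀ᶠ s in 𝓝[<] t, f s < q} with hS
  refine Set.Countable.mono (fun t ht => ?_) (countable_setOfPred_isolated_left_within (s := S))
  refine ⟨ht, ?_⟩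
  have h1 : ∀ᶠ s in 𝓝[S ∩ Set.Iio t] t, f s < q :=
    ht.2.filter_mono (nhdsWithin_mono t Set.inter_subset_right)
  rw [← empty_mem_iff_bot]
  filter_upwards [h1, self_mem_nhdsWithin] with s hs hs'
  exact lt_asymm hs hs'.1.1

/-- A path of `D` has at most countably many discontinuities. -/
lemma D.countable_discont (x : D) : {t | ¬ ContinuousAt x t}.Countable := by
  -- A discontinuity is a jump, and some rational lies strictly between the left limit and the
  -- value; downward jumps are upward jumps of `-x`.
  have h1 : (⋃ q : ℚ, {t | (q : ℝ) < x t ∧ ∀ᶠ s in 𝓝[<] t, x s < q}).Countable :=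
    Set.countable_iUnion fun q => countable_upcrossing x q
  have h2 : (⋃ q : ℚ, {t | (q : ℝ) < - x t ∧ ∀ᶠ s in 𝓝[<] t, - x s < q}).Countable :=
    Set.countable_iUnion fun q => countable_upcrossing (fun t => - x t) q
  refine (h1.union h2).mono fun t ht => ?_
  obtain ⟨l, hl⟩ := x.left_lim t
  have hne : l ≠ x t := by
    rintro rfl
    refine ht ?_
    rw [ContinuousAt, ← nhdsLT_sup_nhdsGE, tendsto_sup]
    exact ⟨hl, x.right_cont t⟩
  rcases lt_or_gt_of_ne hne with h | h
  · obtain ⟨q, hq, hq'⟩ := exists_rat_btwn h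
    exact Or.inl (Set.mem_iUnion.2 ⟨q, hq', hl.eventually (gt_mem_nhds hq)⟩)
  · obtain ⟨q, hq, hq'⟩ := exists_rat_btwn (neg_lt_neg h)
    exact Or.inr (Set.mem_iUnion.2 ⟨q, hq', hl.neg.eventually (gt_mem_nhds hq)⟩)

lemma add_mul_le_add (a h : ℝ≥0) {r : ℝ≥0} (hr : r ≤ 1) : a + h * r ≤ a + h := by
  simpa using add_le_add (le_refl a) (mul_le_mul (le_refl h) hr zero_le zero_le)

lemma shift_le (a h : ℝ≥0) (r : I) : a + h * toNNReal r ≤ a + h :=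
  add_mul_le_add a h (show (r : ℝ) ≤ 1 from r.2.2)

/-- Right-continuity makes `(ω, r) ↦ M ω (a + h r)` jointly measurable. -/
lemma measurable_uncurry_shift {Ω : Type*} {m : MeasurableSpace Ω} {M : Ω → D} (a h : ℝ≥0)
    (hM : ∀ u ≤ a + h, Measurable fun ω => M ω u) :
    Measurable fun p : Ω × I => M p.1 (a + h * toNNReal p.2) := by
  -- `⌈n r⌉ / n` approaches `r` from above, as right-continuity requires, and takes countably many
  -- values; the cap at `1` keeps all times within `a + h`, where measurability is assumed.
  let c : ℕ → I → ℝ≥0 := fun n r => min ((⌈(n : ℝ) * (r : ℝ)⌉₊ : ℝ≥0) / n) 1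
  have hr1 : ∀ r : I, toNNReal r ≤ 1 := fun r => (show (r : ℝ) ≤ 1 from r.2.2)
  refine measurable_of_tendsto_metrizable (f := fun n (p : Ω × I) => M p.1 (a + h * c n p.2))
    (fun n => ?_) ?_
  · have h1 : Measurable fun p : Ω × ℕ => M p.1 (a + h * min ((p.2 : ℝ≥0) / n) 1) :=
      measurable_from_prod_countable_left fun j =>
        hM (a + h * min ((j : ℝ≥0) / n) 1) (add_mul_le_add a h (min_le_right _ _))
    have h2 : Measurable fun p : Ω × I => (p.1, ⌈(n : ℝ) * (p.2 : ℝ)⌉₊) := by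
      refine measurable_fst.prodMk (Nat.measurable_ceil.comp ?_)
      exact measurable_const.mul (measurable_subtype_coe.comp measurable_snd)
    exact h1.comp h2
  · rw [tendsto_pi_nhds]
    rintro ⟨ω, r⟩
    have hc : Tendsto (fun n => c n r) atTop (𝓝 (toNNReal r)) := by
      have := ((tendsto_nat_ceil_mul_div_atTop (R := ℝ) (a := (r : ℝ)) r.2.1).comp
        tendsto_natCast_atTop_atTop).min (tendsto_const_nhds (x := (1 : ℝ)))
      rw [min_eq_left r.2.2] at this
      rw [← NNReal.tendsto_coe]
      refine this.congr fun n => ?_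
      simp [c, mul_comm]
    have hge : ∀ᶠ n in atTop, a + h * c n r ∈ Set.Ici (a + h * toNNReal r) := by
      filter_upwards [eventually_gt_atTop 0] with n hn
      have h1 : toNNReal r ≤ c n r := by
        refine le_min ?_ (hr1 r)
        rw [le_div_iff₀ (by exact_mod_cast hn), mul_comm, ← NNReal.coe_le_coe]
        push_cast
        exact Nat.le_ceil _
      exact add_le_add (le_refl a) (mul_le_mul (le_refl h) h1 zero_le zero_le)
    exact ((M ω).right_cont _).tendsto.comp
      (tendsto_nhdsWithin_iff.2 ⟨(hc.const_mul h).const_add a, hge⟩)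

lemma D.measurable_shift (x : D) (a h : ℝ≥0) :
    Measurable fun r : I => x (a + h * toNNReal r) :=
  (measurable_uncurry_shift (m := ⊤) (M := fun _ : Unit => x) a h
    (fun _ _ => measurable_const)).comp (measurable_const (a := ()).prodMk measurable_id)

lemma D.integrable_shift (x : D) (a h : ℝ≥0) :
    Integrable fun r : I => x (a + h * toNNReal r) := by
  obtain ⟨C, hC⟩ := x.exists_bound (a + h)
  exact Integrable.of_bound (x.measurable_shift a h).aestronglyMeasurable C
    (ae_of_all _ fun r => hC _ (shift_le a h r))

/-- The average of the path `x` over the interval `[a, a + h]`. -/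
noncomputable def avg (a h : ℝ≥0) (x : D) : ℝ := ∫ r : I, x (a + h * toNNReal r)

lemma measurable_avg {Ω : Type*} {m : MeasurableSpace Ω} {M : Ω → D} (a h : ℝ≥0)
    (hM : ∀ u ≤ a + h, Measurable fun ω => M ω u) : Measurable fun ω => avg a h (M ω) :=
  (measurable_uncurry_shift a h hM).stronglyMeasurable.integral_prod_right.measurable

/-- Averages over nondegenerate intervals are `J₁`-continuous. -/
lemma continuous_avg (a : ℝ≥0) {h : ℝ≥0} (hh : 0 < h) : Continuous (avg a h) := by
  have key : ∀ (x : D) (δ : ℝ), 0 < δ → ∃ T : ℝ≥0, ∃ ε : ℝ, 0 < ε ∧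
      ∀ y ∈ nbhd x T ε, |avg a h y - avg a h x| < δ := by
    intro x δ hδ
    by_contra! hcon
    have hpos : ∀ n : ℕ, (0 : ℝ) < 1 / ((n : ℝ) + 1) := fun n => by positivity
    -- The extra unit of time leaves room for time changes, which move points by less than `1 / (n +
    -- 1) ≤ 1`.
    choose y hy hyδ using fun n : ℕ => hcon (a + h + 1) (1 / ((n : ℝ) + 1)) (hpos n)
    choose lam hl hyx using hy
    obtain ⟨C, hC⟩ := x.exists_bound (a + h + 1)
    have hinv : ∀ n u, |((lam n).symm u : ℝ) - u| < 1 / ((n : ℝ) + 1) := fun n u => by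
      have := hl n ((lam n).symm u)
      rwa [OrderIso.apply_symm_apply, abs_sub_comm] at this
    have hle1 : ∀ n : ℕ, 1 / ((n : ℝ) + 1) ≤ 1 := fun n => by
      rw [div_le_one (by positivity)]; linarith [n.cast_nonneg (α := ℝ)]
    have hinvle : ∀ n, ∀ u ≤ a + h, (lam n).symm u ≤ a + h + 1 := fun n u hu => by
      have h1 := (abs_lt.1 (hinv n u)).2
      have h2 : (u : ℝ) ≤ a + h := by exact_mod_cast hu
      rw [← NNReal.coe_le_coe]
      push_cast
      linarith [hle1 n]
    have hclose : ∀ n, ∀ u ≤ a + h, |y n u - x ((lam n).symm u)| < 1 / ((n : ℝ) + 1) :=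
      fun n u hu => by
        have := hyx n _ (hinvle n u hu)
        rwa [OrderIso.apply_symm_apply] at this
    have h0 : Tendsto (fun n : ℕ => 1 / ((n : ℝ) + 1)) atTop (𝓝 0) :=
      tendsto_one_div_add_atTop_nhds_zero_nat
    have hlim : Tendsto (fun n => avg a h (y n)) atTop (𝓝 (avg a h x)) := by
      refine tendsto_integral_of_dominated_convergence (fun _ => C + 1)
        (fun n => ((y n).measurable_shift a h).aestronglyMeasurable) (integrable_const _)
        (fun n => ae_of_all _ fun r => ?_) ?_
      · have h1 := hclose n _ (shift_le a h r)
        have h2 := hC _ (hinvle n _ (shift_le a h r))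
        rw [Real.norm_eq_abs]
        have h3 := abs_le.1 h2
        have h4 := abs_lt.1 h1
        rw [abs_le]
        constructor <;> linarith [hle1 n]
      -- As `h > 0`, the map `r ↦ a + h r` is injective, so only countably many `r`, a null set, hit
      -- a discontinuity of `x`.
      · have hcount : {r : I | ¬ ContinuousAt x (a + h * toNNReal r)}.Countable := by
          refine x.countable_discont.preimage (f := fun r : I => a + h * toNNReal r) ?_
          intro r r' hrr
          have := mul_left_cancel₀ hh.ne' (add_left_cancel hrr)
          exact Subtype.ext (congrArg NNReal.toReal this)
        filter_upwards [hcount.ae_notMem volume] with r hr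
        have hr' : ContinuousAt x (a + h * toNNReal r) := not_not.1 hr
        set u := a + h * toNNReal r with hu
        have hul : Tendsto (fun n => (lam n).symm u) atTop (𝓝 u) := by
          rw [← NNReal.tendsto_coe, tendsto_iff_dist_tendsto_zero]
          exact squeeze_zero (fun _ => dist_nonneg) (fun n => (hinv n u).le) h0
        have hxl := hr'.tendsto.comp hul
        have hd : Tendsto (fun n => y n u - x ((lam n).symm u)) atTop (𝓝 0) :=
          squeeze_zero_norm (fun n => (hclose n u (shift_le a h r)).le) h0
        simpa using hd.add hxl
    obtain ⟨n, hn⟩ := ((Metric.tendsto_nhds.1 hlim) δ hδ).exists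
    exact absurd hn (not_lt.2 (hyδ n))
  refine continuous_def.2 fun U hU => ?_
  intro x hx
  obtain ⟨δ, hδ, hball⟩ := Metric.isOpen_iff.1 hU _ hx
  obtain ⟨T, ε, hε, hy⟩ := key x δ hδ
  exact ⟨T, ε, hε, fun y hyn => hball (hy y hyn)⟩

/-- Averages over shrinking intervals just to the right of `a` converge to the value at `a`. -/
lemma tendsto_avg (x : D) (a : ℝ≥0) {b h : ℕ → ℝ≥0} (hab : ∀ n, a ≤ b n)
    (hb : Tendsto b atTop (𝓝 a)) (hh : Tendsto h atTop (𝓝 0)) :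
    Tendsto (fun n => avg (b n) (h n) x) atTop (𝓝 (x a)) := by
  have hbh : ∀ᶠ n in atTop, b n + h n < a + 1 := by
    have := hb.add hh
    rw [add_zero] at this
    exact this.eventually (gt_mem_nhds (lt_add_one a))
  obtain ⟨C, hC⟩ := x.exists_bound (a + 1)
  have : x a = ∫ _ : I, x a := by simp
  rw [this]
  refine tendsto_integral_filter_of_dominated_convergence (fun _ => C)
    (Eventually.of_forall fun n => (x.measurable_shift _ _).aestronglyMeasurable)
    (hbh.mono fun n hn => ae_of_all _ fun r => hC _ ((shift_le _ _ r).trans hn.le))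
    (integrable_const _) (ae_of_all _ fun r => ?_)
  refine (x.right_cont a).tendsto.comp (tendsto_nhdsWithin_iff.2 ⟨?_, ?_⟩)
  · simpa using hb.add (hh.mul_const (toNNReal r))
  · exact Eventually.of_forall fun n => (hab n).trans le_self_add

end Skorokhod

/-! ### Uniform integrability through the excess over a level -/

section UniformIntegrability

variable {Ω : Type*} {mΩ : MeasurableSpace Ω} {P : Measure Ω}

/-- `|A| ≤ (|A| - K)⁺ + K`. The excess is preferred to the tail `|A| 1{|A| ≥ K}` because it is a
convex function of `A`; `ENNReal.ofReal` takes the positive part. -/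
lemma MeasureTheory.integrable_of_lintegral_excess [IsFiniteMeasure P] {A : Ω → ℝ} {K : ℝ}
    (hA : Measurable A) (h : ∫⁻ ω, ENNReal.ofReal (|A ω| - K) ∂P ≠ ∞) : Integrable A P := by
  refine ⟨hA.aestronglyMeasurable, ?_⟩
  have h1 : ∫⁻ ω, ‖A ω‖ₑ ∂P ≤ ∫⁻ ω, (ENNReal.ofReal (|A ω| - K) + ENNReal.ofReal K) ∂P := by
    refine lintegral_mono fun ω => ?_
    rw [Real.enorm_eq_ofReal_abs]
    have := ENNReal.ofReal_add_le (p := |A ω| - K) (q := K)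
    rwa [sub_add_cancel] at this
  refine h1.trans_lt ?_
  rw [lintegral_add_right _ measurable_const, lintegral_const]
  exact ENNReal.add_lt_top.2 ⟨h.lt_top, ENNReal.mul_lt_top ENNReal.ofReal_lt_top (by simp)⟩

/-- The truncation of `y` to `[-K, K]`. -/
noncomputable def Real.clamp (K y : ℝ) : ℝ := max (-K) (min K y)

lemma Real.continuous_clamp (K : ℝ) : Continuous (Real.clamp K) := by
  unfold Real.clamp; fun_prop

lemma Real.abs_clamp_le {K : ℝ} (hK : 0 ≤ K) (y : ℝ) : |Real.clamp K y| ≤ K :=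
  abs_le.2 ⟨le_max_left _ _, max_le (by linarith) (min_le_left _ _)⟩

lemma Real.clamp_of_abs_le {K y : ℝ} (hy : |y| ≤ K) : Real.clamp K y = y := by
  rw [Real.clamp, min_eq_right (abs_le.1 hy).2, max_eq_right (abs_le.1 hy).1]

lemma Real.abs_sub_clamp_le {K : ℝ} (hK : 0 ≤ K) (y : ℝ) :
    |y - Real.clamp K y| ≤ max (|y| - K) 0 := by
  rcases le_total |y| K with h | h
  · simp [Real.clamp_of_abs_le h]
  · refine le_max_of_le_left ?_
    rcases abs_cases y with ⟨h1, h2⟩ | ⟨h1, h2⟩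
    · rw [Real.clamp, min_eq_left (by linarith), max_eq_right (by linarith), abs_le]
      constructor <;> linarith
    · rw [Real.clamp, min_eq_right (by linarith), max_eq_left (by linarith), abs_le]
      constructor <;> linarith

/-- Clamping `A` at `K` moves it by at most its excess over `K`. Clamping `Z` at its own bound
changes nothing, but makes the integrand a bounded continuous function on all of `ℝ × ℝ`. -/
lemma MeasureTheory.abs_integral_mul_sub_clamp_le [IsFiniteMeasure P] {A Z : Ω → ℝ} {C K : ℝ}
    {e : ℝ≥0∞} (hA : Measurable A) (hZ : Measurable Z) (hC : 0 ≤ C) (hZC : ∀ ω, |Z ω| ≤ C)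
    (hK : 0 ≤ K) (he : e ≠ ∞) (hAe : ∫⁻ ω, ENNReal.ofReal (|A ω| - K) ∂P ≤ e) :
    |∫ ω, A ω * Z ω ∂P - ∫ ω, Real.clamp K (A ω) * Real.clamp C (Z ω) ∂P| ≤ C * e.toReal := by
  have hAi : Integrable A P := integrable_of_lintegral_excess hA (ne_top_of_le_ne_top he hAe)
  have hcl : Integrable (fun ω => Real.clamp K (A ω)) P :=
    Integrable.of_bound ((Real.continuous_clamp K).measurable.comp hA).aestronglyMeasurable K
      (ae_of_all _ fun ω => Real.abs_clamp_le hK _)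
  have hZb : ∀ᵐ ω ∂P, ‖Z ω‖ ≤ C := ae_of_all _ hZC
  have hexc : Integrable (fun ω => max (|A ω| - K) 0) P :=
    (hAi.abs.sub (integrable_const K)).pos_part
  simp_rw [fun ω => Real.clamp_of_abs_le (hZC ω)]
  rw [← integral_sub (hAi.mul_bdd hZ.aestronglyMeasurable hZb)
    (hcl.mul_bdd hZ.aestronglyMeasurable hZb)]
  have hexc' : ∫ ω, max (|A ω| - K) 0 ∂P ≤ e.toReal := by
    rw [integral_eq_lintegral_of_nonneg_ae (f := fun ω => max (|A ω| - K) 0)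
      (ae_of_all _ fun ω => le_max_right _ _)
      hexc.aestronglyMeasurable]
    refine ENNReal.toReal_mono he (le_trans (le_of_eq ?_) hAe)
    simp [ENNReal.ofReal_max]
  calc |∫ ω, (A ω * Z ω - Real.clamp K (A ω) * Z ω) ∂P|
      ≤ ∫ ω, max (|A ω| - K) 0 * C ∂P := by
        rw [← Real.norm_eq_abs]
        refine norm_integral_le_of_norm_le (hexc.mul_const C) (ae_of_all _ fun ω => ?_)
        rw [← sub_mul, norm_mul]
        exact mul_le_mul (Real.abs_sub_clamp_le hK _) (hZC ω) (norm_nonneg _) (le_max_right _ _)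
    _ = C * ∫ ω, max (|A ω| - K) 0 ∂P := by rw [integral_mul_const, mul_comm]
    _ ≤ C * e.toReal := mul_le_mul_of_nonneg_left hexc' hC

lemma MeasureTheory.ofReal_integral_of_le [IsFiniteMeasure P] {f : Ω → ℝ} (hf : Measurable f)
    (h0 : ∀ ω, 0 ≤ f ω) {C : ℝ} (hC : ∀ ω, f ω ≤ C) :
    ENNReal.ofReal (∫ ω, f ω ∂P) = ∫⁻ ω, ENNReal.ofReal (f ω) ∂P := by
  refine ofReal_integral_eq_lintegral_ofReal (Integrable.of_bound hf.aestronglyMeasurable C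
    (ae_of_all _ fun ω => ?_)) (ae_of_all _ h0)
  rw [Real.norm_eq_abs, abs_of_nonneg (h0 ω)]
  exact hC ω

/-- If the pairs `(A n, Z n)` converge in distribution, the `A n` are uniformly integrable and the
`Z n` are uniformly bounded, then the bound on the tails passes to the limit and the expectations of
the products converge. -/
theorem MeasureTheory.tendsto_integral_mul_of_uniformIntegrable {Ωn : ℕ → Type*}
    [∀ n, MeasurableSpace (Ωn n)] {Pn : ∀ n, Measure (Ωn n)} [∀ n, IsProbabilityMeasure (Pn n)]
    [IsProbabilityMeasure P] {A Z : ∀ n, Ωn n → ℝ} {A' Z' : Ω → ℝ}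
    (hA : ∀ n, Measurable (A n)) (hZ : ∀ n, Measurable (Z n))
    (hA' : Measurable A') (hZ' : Measurable Z') {C : ℝ} (hC : 0 ≤ C)
    (hZC : ∀ n ω, |Z n ω| ≤ C) (hZC' : ∀ ω, |Z' ω| ≤ C)
    (H : ∀ g : BoundedContinuousFunction (ℝ × ℝ) ℝ,
      Tendsto (fun n => ∫ ω, g (A n ω, Z n ω) ∂(Pn n)) atTop (𝓝 (∫ ω, g (A' ω, Z' ω) ∂P)))
    {e : ℝ → ℝ≥0∞} (he : Tendsto e atTop (𝓝 0))
    (hAe : ∀ n K, 0 ≤ K → ∫⁻ ω, ENNReal.ofReal (|A n ω| - K) ∂(Pn n) ≤ e K) :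
    (∀ K, 0 ≤ K → ∫⁻ ω, ENNReal.ofReal (|A' ω| - K) ∂P ≤ e K) ∧ Integrable A' P ∧
      Tendsto (fun n => ∫ ω, A n ω * Z n ω ∂(Pn n)) atTop (𝓝 (∫ ω, A' ω * Z' ω ∂P)) := by
  have h1 : ∀ K, 0 ≤ K → ∫⁻ ω, ENNReal.ofReal (|A' ω| - K) ∂P ≤ e K := by
    intro K hK
    -- The cap at `L` makes the excess a bounded continuous test function; monotone convergence in
    -- `L` removes it.
    let f : ℕ → ℝ → ℝ := fun L y => min (max (|y| - K) 0) L
    have hfc : ∀ L, Continuous (f L) := fun L => by fun_prop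
    have hf0 : ∀ L y, 0 ≤ f L y := fun L y => le_min (le_max_right _ _) L.cast_nonneg
    have hfL : ∀ L y, f L y ≤ L := fun L y => min_le_right _ _
    have hL : ∀ L : ℕ, ∫⁻ ω, ENNReal.ofReal (f L (A' ω)) ∂P ≤ e K := by
      intro L
      let g : BoundedContinuousFunction (ℝ × ℝ) ℝ :=
        BoundedContinuousFunction.ofNormedAddCommGroup (fun p => f L p.1)
          ((hfc L).comp continuous_fst) L (fun p => by
            rw [Real.norm_eq_abs, abs_of_nonneg (hf0 _ _)]; exact hfL _ _)
      have hg := ENNReal.tendsto_ofReal (H g)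
      change Tendsto (fun n => ENNReal.ofReal (∫ ω, f L (A n ω) ∂Pn n)) atTop
        (𝓝 (ENNReal.ofReal (∫ ω, f L (A' ω) ∂P))) at hg
      rw [ofReal_integral_of_le (f := fun ω => f L (A' ω)) ((hfc L).measurable.comp hA') (fun ω => hf0 _ _)
        (fun ω => hfL _ _)] at hg
      refine le_of_tendsto' hg fun n => ?_
      rw [ofReal_integral_of_le (f := fun ω => f L (A n ω)) ((hfc L).measurable.comp (hA n)) (fun ω => hf0 _ _)
        (fun ω => hfL _ _)]
      refine le_trans (lintegral_mono fun ω => ?_) (hAe n K hK)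
      refine (ENNReal.ofReal_le_ofReal (min_le_left _ _)).trans ?_
      simp [ENNReal.ofReal_max]
    refine le_of_tendsto' (lintegral_tendsto_of_tendsto_of_monotone
      (f := fun L ω => ENNReal.ofReal (f L (A' ω))) (fun L => ?_) (ae_of_all _ fun ω => ?_)
      (ae_of_all _ fun ω => ?_)) hL
    · exact (((hfc L).measurable.comp hA').ennreal_ofReal).aemeasurable
    · intro L L' hLL
      exact ENNReal.ofReal_le_ofReal (min_le_min_left _ (by exact_mod_cast hLL))
    · refine tendsto_const_nhds.congr' ?_
      filter_upwards [eventually_ge_atTop ⌈max (|A' ω| - K) 0⌉₊] with L hL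
      have : max (|A' ω| - K) 0 ≤ L := Nat.ceil_le.1 hL
      simp only [f]
      rw [min_eq_left this]
      simp [ENNReal.ofReal_max]
  have hfin : ∀ δ : ℝ, 0 < δ → ∃ K, 0 ≤ K ∧ e K ≠ ∞ ∧ C * (e K).toReal < δ := by
    intro δ hδ
    have h2 : Tendsto (fun K => C * (e K).toReal) atTop (𝓝 0) := by
      have := ((ENNReal.tendsto_toReal ENNReal.zero_ne_top).comp he).const_mul C
      simpa using this
    obtain ⟨K, hK⟩ := ((eventually_ge_atTop 0).and
      ((he.eventually (gt_mem_nhds ENNReal.zero_lt_top)).and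
        (h2.eventually (gt_mem_nhds hδ)))).exists
    exact ⟨K, hK.1, hK.2.1.ne, hK.2.2⟩
  refine ⟨h1, ?_, ?_⟩
  · obtain ⟨K, hK, hK', -⟩ := hfin 1 one_pos
    exact integrable_of_lintegral_excess hA' (ne_top_of_le_ne_top hK' (h1 K hK))
  · rw [Metric.tendsto_nhds]
    intro δ hδ
    obtain ⟨K, hK, hK', hKδ⟩ := hfin (δ / 3) (by positivity)
    let g : BoundedContinuousFunction (ℝ × ℝ) ℝ :=
      BoundedContinuousFunction.ofNormedAddCommGroup (fun p => Real.clamp K p.1 * Real.clamp C p.2)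
        (((Real.continuous_clamp K).comp continuous_fst).mul
          ((Real.continuous_clamp C).comp continuous_snd)) (K * C) (fun p => by
            rw [norm_mul]
            exact mul_le_mul (Real.abs_clamp_le hK _) (Real.abs_clamp_le hC _) (norm_nonneg _) hK)
    filter_upwards [Metric.tendsto_nhds.1 (H g) (δ / 3) (by positivity)] with n hn
    change |∫ ω, Real.clamp K (A n ω) * Real.clamp C (Z n ω) ∂(Pn n) -
      ∫ ω, Real.clamp K (A' ω) * Real.clamp C (Z' ω) ∂P| < δ / 3 at hn
    have h3 := abs_integral_mul_sub_clamp_le (hA n) (hZ n) hC (hZC n) hK hK' (hAe n K hK)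
    have h4 := abs_integral_mul_sub_clamp_le hA' hZ' hC hZC' hK hK' (h1 K hK)
    rw [Real.dist_eq, abs_lt]
    rw [abs_lt] at hn
    rw [abs_le] at h3 h4
    constructor <;> linarith [hn.1, hn.2, h3.1, h3.2, h4.1, h4.2]

/-- Conditional Jensen for `y ↦ (|y| - K)⁺`: conditioning `|Y| ≤ K + (|Y| - K)⁺` bounds the excess
of the conditional expectation by the conditional expectation of the excess. -/
lemma MeasureTheory.lintegral_excess_condExp_le [IsFiniteMeasure P] {m : MeasurableSpace Ω}
    (hm : m ≤ mΩ) {Y : Ω → ℝ} (hY : Integrable Y P) (K : ℝ) :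
    ∫⁻ ω, ENNReal.ofReal (|(P[Y | m]) ω| - K) ∂P ≤ ∫⁻ ω, ENNReal.ofReal (|Y ω| - K) ∂P := by
  set E : Ω → ℝ := fun ω => max (|Y ω| - K) 0 with hE
  have hEi : Integrable E P := (hY.abs.sub (integrable_const K)).pos_part
  have h1 : P[(fun ω => |Y ω|) | m] ≤ᵐ[P] P[fun ω => K + E ω | m] := by
    refine condExp_mono hY.abs ((integrable_const K).add hEi) (ae_of_all _ fun ω => ?_)
    have := le_max_left (|Y ω| - K) 0
    simp only [hE]
    linarith
  have h2 : P[fun ω => K + E ω | m] =ᵐ[P] P[fun _ => K | m] + P[E | m] :=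
    condExp_add (integrable_const K) hEi m
  rw [condExp_const hm] at h2
  have h3 : ∀ᵐ ω ∂P, 0 ≤ (P[E | m]) ω :=
    condExp_nonneg (ae_of_all _ fun ω => le_max_right _ _)
  calc ∫⁻ ω, ENNReal.ofReal (|(P[Y | m]) ω| - K) ∂P
      ≤ ∫⁻ ω, ENNReal.ofReal ((P[E | m]) ω) ∂P := by
        refine lintegral_mono_ae ?_
        filter_upwards [abs_condExp_ae_le_condExp_abs (μ := P) (m := m) Y, h1, h2]
          with ω a1 a2 a3
        refine ENNReal.ofReal_le_ofReal ?_
        change |(P[Y | m]) ω| ≤ (P[(fun ω => |Y ω|) | m]) ω at a1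
        rw [Pi.add_apply] at a3
        linarith
    _ = ∫⁻ ω, ENNReal.ofReal (E ω) ∂P := by
        rw [← ofReal_integral_eq_lintegral_ofReal integrable_condExp h3, integral_condExp hm,
          ofReal_integral_eq_lintegral_ofReal hEi (ae_of_all _ fun ω => le_max_right _ _)]
    _ = ∫⁻ ω, ENNReal.ofReal (|Y ω| - K) ∂P := by simp [hE, ENNReal.ofReal_max]

lemma MeasureTheory.Martingale.integral_mul_eq [IsFiniteMeasure P] {ι : Type*} [Preorder ι]
    {ℱ : Filtration ι mΩ} {M : ι → Ω → ℝ} (hM : Martingale M ℱ P) {s t : ι} (hst : s ≤ t)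
    {Z : Ω → ℝ} (hZ : Measurable[ℱ s] Z) {C : ℝ} (hZC : ∀ ω, |Z ω| ≤ C) :
    ∫ ω, M t ω * Z ω ∂P = ∫ ω, M s ω * Z ω ∂P := by
  have h1 := condExp_stronglyMeasurable_mul_of_bound (ℱ.le s) hZ.stronglyMeasurable
    (hM.integrable t) C (ae_of_all P hZC)
  have h2 : ∫ ω, (P[Z * M t | ℱ s]) ω ∂P = ∫ ω, (Z * M t) ω ∂P := integral_condExp (ℱ.le s)
  simp_rw [mul_comm _ (Z _)]
  refine h2.symm.trans (integral_congr_ae ?_)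
  filter_upwards [h1, hM.2 s t hst] with ω a1 a2
  rw [a1, Pi.mul_apply, a2]

end UniformIntegrability

/-! ### From finite-dimensional test functions to events of the past -/

section SignedMarginals

variable {Ω : Type*} {mΩ : MeasurableSpace Ω} {P : Measure Ω}

/-- If `f` is orthogonal to all bounded continuous functions of finitely many of the variables
`Y j`, then its integral over every event generated by the family `Y` vanishes. -/
theorem MeasureTheory.setIntegral_eq_zero_of_forall_finset {ι E : Type*} [PseudoMetricSpace E]
    [SecondCountableTopology E] [MeasurableSpace E] [BorelSpace E] {Y : ι → Ω → E}
    (hY : ∀ j, Measurable (Y j)) {f : Ω → ℝ} (hf : Integrable f P) (hfm : Measurable f)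
    (H : ∀ (S : Finset ι) (g : BoundedContinuousFunction (S → E) ℝ),
      ∫ ω, f ω * g (fun j => Y j ω) ∂P = 0)
    {A : Set Ω} (hA : MeasurableSet[.comap (fun ω j => Y j ω) inferInstance] A) :
    ∫ ω in A, f ω ∂P = 0 := by
  have hΦ : Measurable fun ω j => Y j ω := measurable_pi_lambda _ hY
  have hfin : ∀ {u : Ω → ℝ}, Integrable u P →
      IsFiniteMeasure (P.withDensity fun ω => ENNReal.ofReal (u ω)) := fun hu =>
    isFiniteMeasure_withDensity_ofReal hu.2
  have := hfin hf
  have := hfin hf.neg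
  have hpos : Measurable fun ω => ENNReal.ofReal (f ω) := hfm.ennreal_ofReal
  have hneg : Measurable fun ω => ENNReal.ofReal ((-f) ω) := hfm.neg.ennreal_ofReal
  -- The positive and negative parts of `f` are densities of two finite measures. The hypothesis
  -- says that their images under `Y` have the same finite-dimensional marginals, so these images
  -- coincide.
  set ρ := P.withDensity fun ω => ENNReal.ofReal (f ω) with hρ
  set ρ' := P.withDensity fun ω => ENNReal.ofReal ((-f) ω) with hρ'
  have hmarg : ∀ S : Finset ι, (ρ.map fun ω j => Y j ω).map S.restrict =
      (ρ'.map fun ω j => Y j ω).map S.restrict := by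
    intro S
    have hS : Measurable (S.restrict : (ι → E) → S → E) := Finset.measurable_restrict S
    refine ext_of_forall_integral_eq_of_IsFiniteMeasure fun g => ?_
    have hgY : Measurable fun ω => g (fun j : S => Y j ω) :=
      g.continuous.measurable.comp (measurable_pi_lambda _ fun j => hY j)
    have hint : ∀ {u : Ω → ℝ}, Integrable u P →
        Integrable (fun ω => max (u ω) 0 * g (fun j : S => Y j ω)) P := fun hu =>
      hu.pos_part.mul_bdd (c := ‖g‖) hgY.aestronglyMeasurable
        (ae_of_all _ fun ω => g.norm_coe_le_norm _)
    have hmap : ∀ Q : Measure Ω, ∫ x, g x ∂(Q.map fun ω j => Y j ω).map S.restrict =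
        ∫ ω, g (fun j : S => Y j ω) ∂Q := fun Q => by
      rw [Measure.map_map hS hΦ, integral_map (hS.comp hΦ).aemeasurable
        g.continuous.measurable.aestronglyMeasurable]
      rfl
    rw [hmap, hmap, hρ, hρ',
      integral_withDensity_eq_integral_toReal_smul hpos (ae_of_all _ fun _ => by simp),
      integral_withDensity_eq_integral_toReal_smul hneg (ae_of_all _ fun _ => by simp),
      ← sub_eq_zero]
    simp only [ENNReal.toReal_ofReal', smul_eq_mul]
    rw [← integral_sub (hint hf) (hint hf.neg)]
    refine (integral_congr_ae (ae_of_all _ fun ω => ?_)).trans (H S g)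
    simp only [Pi.neg_apply]
    rw [← sub_mul]
    congr 1
    rcases le_total (f ω) 0 with h | h
    · rw [max_eq_right h, max_eq_left (by linarith)]; ring
    · rw [max_eq_left h, max_eq_right (by linarith)]; ring
  have hmap : (ρ.map fun ω j => Y j ω) = ρ'.map fun ω j => Y j ω :=
    IsProjectiveLimit.unique (P := fun S => (ρ'.map fun ω j => Y j ω).map S.restrict)
      hmarg fun _ => rfl
  obtain ⟨B, hB, rfl⟩ := hA
  have hAB : ρ ((fun ω j => Y j ω) ⁻¹' B) = ρ' ((fun ω j => Y j ω) ⁻¹' B) := by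
    rw [← Measure.map_apply hΦ hB, hmap, Measure.map_apply hΦ hB]
  rw [hρ, hρ', withDensity_apply _ (hΦ hB), withDensity_apply _ (hΦ hB)] at hAB
  rw [integral_eq_lintegral_pos_part_sub_lintegral_neg_part hf.integrableOn, hAB]
  exact sub_self _

lemma MeasureTheory.martingale_of_setIntegral_eq [IsFiniteMeasure P] {ι : Type*} [Preorder ι]
    {ℱ : Filtration ι mΩ} {M : ι → Ω → ℝ} (hadp : StronglyAdapted ℱ M)
    (hint : ∀ t, Integrable (M t) P)
    (h : ∀ s t, s ≤ t → ∀ A, MeasurableSet[ℱ s] A → ∫ ω in A, M s ω ∂P = ∫ ω in A, M t ω ∂P) :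
    Martingale M ℱ P :=
  ⟨hadp, fun s t hst => (ae_eq_condExp_of_forall_setIntegral_eq (ℱ.le s) (hint t)
    (fun _ _ _ => (hint s).integrableOn) (fun A hA _ => h s t hst A hA)
    (hadp s).aestronglyMeasurable).symm⟩

end SignedMarginals

namespace Skorokhod

open unitInterval

/-! ### Averages of martingales -/

section Averages

variable {Ω : Type*} {mΩ : MeasurableSpace Ω} {P : Measure Ω} [IsFiniteMeasure P] {M : Ω → D}

/-- Jensen's inequality for the uniform law on `[a, a + h]`. -/
lemma ofReal_excess_avg_le (x : D) (a h : ℝ≥0) (K : ℝ) :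
    ENNReal.ofReal (|avg a h x| - K) ≤
      ∫⁻ r : I, ENNReal.ofReal (|x (a + h * toNNReal r)| - K) := by
  have hi := x.integrable_shift a h
  have hexc : Integrable fun r : I => max (|x (a + h * toNNReal r)| - K) 0 :=
    (hi.abs.sub (integrable_const K)).pos_part
  have h1 : |avg a h x| - K ≤ ∫ r : I, max (|x (a + h * toNNReal r)| - K) 0 := by
    have h2 : |avg a h x| ≤ ∫ r : I, |x (a + h * toNNReal r)| := abs_integral_le_integral_abs
    have h3 : ∫ r : I, (|x (a + h * toNNReal r)| - K) ≤
        ∫ r : I, max (|x (a + h * toNNReal r)| - K) 0 :=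
      integral_mono (hi.abs.sub (integrable_const K)) hexc fun r => le_max_left _ _
    rw [integral_sub hi.abs (integrable_const K)] at h3
    simp only [integral_const, probReal_univ, one_smul] at h3
    linarith
  refine (ENNReal.ofReal_le_ofReal h1).trans (le_of_eq ?_)
  rw [ofReal_integral_eq_lintegral_ofReal hexc (ae_of_all _ fun r => le_max_right _ _)]
  simp [ENNReal.ofReal_max]

lemma lintegral_excess_avg_le (hM : Measurable M) {a h : ℝ≥0} {K : ℝ} {c : ℝ≥0∞}
    (hc : ∀ u ≤ a + h, ∫⁻ ω, ENNReal.ofReal (|M ω u| - K) ∂P ≤ c) :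
    ∫⁻ ω, ENNReal.ofReal (|avg a h (M ω)| - K) ∂P ≤ c := by
  have hm : Measurable fun p : Ω × I => ENNReal.ofReal (|M p.1 (a + h * toNNReal p.2)| - K) :=
    ((measurable_uncurry_shift a h
      fun u _ => (measurable_eval u).comp hM).norm.sub_const K).ennreal_ofReal
  calc ∫⁻ ω, ENNReal.ofReal (|avg a h (M ω)| - K) ∂P
      ≤ ∫⁻ ω, (∫⁻ r : I, ENNReal.ofReal (|M ω (a + h * toNNReal r)| - K)) ∂P :=
        lintegral_mono fun ω => ofReal_excess_avg_le _ _ _ _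
    _ = ∫⁻ r : I, ∫⁻ ω, ENNReal.ofReal (|M ω (a + h * toNNReal r)| - K) ∂P :=
        lintegral_lintegral_swap hm.aemeasurable
    _ ≤ ∫⁻ _ : I, c := lintegral_mono fun r => hc _ (shift_le a h r)
    _ = c := by simp

/-- By Fubini the average can be taken outside the expectation, where every time in `[a, a + h]` is
at least `s` and the martingale property applies. Joint integrability follows from `E|M(u)| ≤ E|M(a
+ h)|`. -/
lemma integral_avg_mul {ℱ : Filtration ℝ≥0 mΩ} (hM : Measurable M)
    (hmart : Martingale (fun t ω => M ω t) ℱ P) {s a h : ℝ≥0} (hsa : s ≤ a)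
    {Z : Ω → ℝ} (hZ : Measurable[ℱ s] Z) {C : ℝ} (hZC : ∀ ω, |Z ω| ≤ C) :
    ∫ ω, avg a h (M ω) * Z ω ∂P = ∫ ω, M ω s * Z ω ∂P := by
  have hZm : Measurable Z := hZ.mono (ℱ.le s) le_rfl
  have hm : Measurable fun p : Ω × I => M p.1 (a + h * toNNReal p.2) * Z p.1 :=
    (measurable_uncurry_shift a h
      fun u _ => (measurable_eval u).comp hM).mul (hZm.comp measurable_fst)
  have hint : ∀ u, Integrable (fun ω => M ω u * Z ω) P := fun u =>
    (hmart.integrable u).mul_bdd (c := C) hZm.aestronglyMeasurable (ae_of_all _ hZC)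
  have hbd : ∀ u ≤ a + h, ∫ ω, ‖M ω u * Z ω‖ ∂P ≤ (∫ ω, |M ω (a + h)| ∂P) * C := by
    intro u hu
    have h1 : ∫ ω, |M ω u| ∂P ≤ ∫ ω, |M ω (a + h)| ∂P := by
      refine le_trans (le_of_eq (integral_congr_ae ?_))
        (integral_abs_condExp_le (m := ℱ u) (fun ω => M ω (a + h)))
      filter_upwards [hmart.2 u (a + h) hu] with ω hω
      rw [hω]
    calc ∫ ω, ‖M ω u * Z ω‖ ∂P ≤ ∫ ω, |M ω u| * C ∂P := by
          refine integral_mono (hint u).norm ((hmart.integrable u).abs.mul_const C) fun ω => ?_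
          rw [norm_mul]
          exact mul_le_mul_of_nonneg_left (hZC ω) (norm_nonneg _)
      _ = (∫ ω, |M ω u| ∂P) * C := integral_mul_const _ _
      _ ≤ _ := by
          -- The sign of `C` is known only if some `ω` exists.
          rcases isEmpty_or_nonempty Ω with hΩ | ⟨⟨ω⟩⟩
          · simp [Measure.eq_zero_of_isEmpty P]
          · exact mul_le_mul_of_nonneg_right h1 ((abs_nonneg _).trans (hZC ω))
  have hprod : Integrable (fun p : Ω × I => M p.1 (a + h * toNNReal p.2) * Z p.1)
      (P.prod volume) := by
    rw [integrable_prod_iff' hm.aestronglyMeasurable]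
    refine ⟨ae_of_all _ fun r => hint (a + h * toNNReal r), Integrable.of_bound
      (hm.norm.stronglyMeasurable.integral_prod_left').aestronglyMeasurable
      ((∫ ω, |M ω (a + h)| ∂P) * C) (ae_of_all _ fun r => ?_)⟩
    rw [Real.norm_of_nonneg (integral_nonneg fun ω => norm_nonneg _)]
    exact hbd _ (shift_le a h r)
  calc ∫ ω, avg a h (M ω) * Z ω ∂P = ∫ ω, (∫ r : I, M ω (a + h * toNNReal r) * Z ω) ∂P := by
        simp_rw [integral_mul_const]
        rfl
    _ = ∫ r : I, ∫ ω, M ω (a + h * toNNReal r) * Z ω ∂P := integral_integral_swap hprod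
    _ = ∫ _ : I, ∫ ω, M ω s * Z ω ∂P := by
        congr 1 with r
        exact hmart.integral_mul_eq (hsa.trans le_self_add) hZ hZC
    _ = ∫ ω, M ω s * Z ω ∂P := by simp

end Averages

/-! ### Values and averages of the pair `(X, M)` -/

section Pairs

variable {k : ℕ}

/-- The value at time `t` of a path in `D^{k+1}`, as an element of `ℝ^k × ℝ`. -/
def evalPair (t : ℝ≥0) (w : Dpow (k + 1)) : (Fin k → ℝ) × ℝ :=
  (fun i => w i.castSucc t, w (Fin.last k) t)

/-- The coordinatewise averages over `[a, a + h]` of a path in `D^{k+1}`. -/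
noncomputable def avgPair (a h : ℝ≥0) (w : Dpow (k + 1)) : (Fin k → ℝ) × ℝ :=
  (fun i => avg a h (w i.castSucc), avg a h (w (Fin.last k)))

lemma Dpow.continuous_apply (i : Fin k) : Continuous fun w : Dpow k => w i :=
  show Continuous (fun w : Fin k → D => w i) from _root_.continuous_apply i

lemma continuous_avgPair (a : ℝ≥0) {h : ℝ≥0} (hh : 0 < h) :
    Continuous (avgPair a h : Dpow (k + 1) → _) :=
  (continuous_pi fun i : Fin k => (continuous_avg a hh).comp (Dpow.continuous_apply i.castSucc)).prodMk
    ((continuous_avg a hh).comp (Dpow.continuous_apply (Fin.last k)))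

lemma tendsto_avgPair (w : Dpow (k + 1)) (a : ℝ≥0) {h : ℕ → ℝ≥0} (hh : Tendsto h atTop (𝓝 0)) :
    Tendsto (fun n => avgPair a (h n) w) atTop (𝓝 (evalPair a w)) :=
  (tendsto_pi_nhds.2 fun _ => tendsto_avg _ a (fun _ => le_rfl) tendsto_const_nhds hh).prodMk_nhds
    (tendsto_avg _ a (fun _ => le_rfl) tendsto_const_nhds hh)

lemma Dpow.snoc_last (x : Dpow k) (y : D) : x.snoc y (Fin.last k) = y :=
  Fin.snoc_last (α := fun _ => D) y x

lemma Dpow.snoc_castSucc (x : Dpow k) (y : D) (i : Fin k) : x.snoc y i.castSucc = x i :=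
  Fin.snoc_castSucc (α := fun _ => D) y x i

lemma evalPair_snoc (t : ℝ≥0) (x : Dpow k) (y : D) :
    evalPair t (x.snoc y) = (fun i => x i t, y t) := by
  simp only [evalPair, Dpow.snoc_last, Dpow.snoc_castSucc]

lemma measurable_avgPair {Ω : Type*} {m : MeasurableSpace Ω} {W : Ω → Dpow (k + 1)} {a h : ℝ≥0}
    (hW : ∀ u ≤ a + h, Measurable fun ω => evalPair u (W ω)) :
    Measurable fun ω => avgPair a h (W ω) :=
  (measurable_pi_lambda _ fun i => measurable_avg a h fun u hu =>
    (measurable_pi_apply i).comp (hW u hu).fst).prodMk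
      (measurable_avg a h fun u hu => (hW u hu).snd)

lemma measurable_comp_avgPair {Ω ι : Type*} {m : MeasurableSpace Ω} {W : Ω → Dpow (k + 1)}
    {τ : ι → ℝ≥0} {h : ℝ≥0} (hW : ∀ j, ∀ u ≤ τ j + h, Measurable fun ω => evalPair u (W ω))
    {g : (ι → (Fin k → ℝ) × ℝ) → ℝ} (hg : Measurable g) :
    Measurable fun ω => g fun j => avgPair (τ j) h (W ω) :=
  hg.comp (measurable_pi_lambda _ fun j => measurable_avgPair (hW j))

variable {Ω : Type*} [mΩ : MeasurableSpace Ω] {X : Ω → Dpow k} {M : Ω → D}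

lemma measurable_evalPair_snoc (hX : Measurable X) (hM : Measurable M) {s t : ℝ≥0} (hst : s ≤ t) :
    Measurable[filtrationOfPair X M hX hM t] fun ω => evalPair s ((X ω).snoc (M ω)) := by
  simp_rw [evalPair_snoc]
  exact ((Filtration.stronglyAdapted_natural _ s).mono
    ((filtrationOfPair X M hX hM).mono hst)).measurable

lemma measurable_eval_filtrationOfPair (hX : Measurable X) (hM : Measurable M) {s t : ℝ≥0}
    (hst : s ≤ t) : Measurable[filtrationOfPair X M hX hM t] fun ω => M ω s := by
  have := (measurable_evalPair_snoc hX hM hst).snd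
  simpa only [evalPair_snoc] using this

lemma filtrationOf_le_filtrationOfPair (hX : Measurable X) (hM : Measurable M) :
    filtrationOf M hM ≤ filtrationOfPair X M hX hM := fun _ =>
  iSup₂_le fun _ hst => (measurable_eval_filtrationOfPair hX hM hst).comap_le

end Pairs

end Skorokhod

/-! ### Passage to the limit -/

lemma MeasureTheory.TendstoInDistribution.tendsto_integral {ι Ω' E : Type*} {Ω : ι → Type*}
    {m : ∀ i, MeasurableSpace (Ω i)} {μ : ∀ i, Measure (Ω i)} [∀ i, IsProbabilityMeasure (μ i)]
    {m' : MeasurableSpace Ω'} {μ' : Measure Ω'} [IsProbabilityMeasure μ'] [TopologicalSpace E]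
    [MeasurableSpace E] [OpensMeasurableSpace E] {Y : ∀ i, Ω i → E} {l : Filter ι} {Y' : Ω' → E}
    (h : TendstoInDistribution Y l Y' μ μ') (g : BoundedContinuousFunction E ℝ) :
    Tendsto (fun i => ∫ ω, g (Y i ω) ∂(μ i)) l (𝓝 (∫ ω, g (Y' ω) ∂μ')) := by
  have h1 := ProbabilityMeasure.tendsto_iff_forall_integral_tendsto.1 h.tendsto g
  have hg : ∀ Q : Measure E, AEStronglyMeasurable g Q := fun Q =>
    g.continuous.measurable.aestronglyMeasurable
  simp only [ProbabilityMeasure.coe_mk] at h1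
  rw [integral_map h.aemeasurable_limit (hg _)] at h1
  exact h1.congr fun i => integral_map (h.forall_aemeasurable i) (hg _)

namespace Skorokhod

section Limit

variable {k : ℕ} {Ωn : ℕ → Type*} [∀ n, MeasurableSpace (Ωn n)] {Pn : ∀ n, Measure (Ωn n)}
  [∀ n, IsProbabilityMeasure (Pn n)] {Ω : Type*} [MeasurableSpace Ω] {P : Measure Ω}
  [IsProbabilityMeasure P] {Xn : ∀ n, Ωn n → Dpow k} {Mn : ∀ n, Ωn n → D}
  {X : Ω → Dpow k} {M : Ω → D}

lemma lintegral_excess_le_iSup {ι : Type*} {Ω : ι → Type*} [∀ i, MeasurableSpace (Ω i)]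
    {P : ∀ i, Measure (Ω i)} {f : ∀ i, Ω i → ℝ} (hf : ∀ i, Measurable (f i)) (i : ι) {K : ℝ}
    (hK : 0 ≤ K) :
    ∫⁻ ω, ENNReal.ofReal (|f i ω| - K) ∂(P i) ≤
      ⨆ i, ∫⁻ ω in {ω | K ≤ |f i ω|}, ENNReal.ofReal |f i ω| ∂(P i) := by
  refine le_iSup_of_le i ?_
  have hm : MeasurableSet {ω | K ≤ |f i ω|} := measurableSet_le measurable_const (hf i).norm
  rw [← lintegral_indicator hm]
  refine lintegral_mono fun ω => ?_
  by_cases h : K ≤ |f i ω|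
  · rw [Set.indicator_of_mem (show ω ∈ {ω | K ≤ |f i ω|} from h)]
    exact ENNReal.ofReal_le_ofReal (by linarith)
  · rw [ENNReal.ofReal_of_nonpos (by linarith [not_le.1 h])]
    exact zero_le

/-- The limit `n → ∞` at fixed `h`. The averages of `M` start at `t + h` and `s + h` because the
test variable looks ahead to time `s + h`. The excess bound is part of the conclusion since it is
used again when `h → 0`. -/
lemma limit_avg
    (hXn : ∀ n, Measurable (Xn n)) (hMn : ∀ n, Measurable (Mn n))
    (hX : Measurable X) (hM : Measurable M)
    (hmart : ∀ n, Martingale (fun (t : ℝ≥0) (ω : Ωn n) => Mn n ω t)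
      (filtrationOfPair (Xn n) (Mn n) (hXn n) (hMn n)) (Pn n))
    (hconv : TendstoInDistribution (fun n (ω : Ωn n) => (Xn n ω).snoc (Mn n ω)) atTop
      (fun ω : Ω => (X ω).snoc (M ω)) Pn P)
    {s t T h : ℝ≥0} (hst : s ≤ t) (hh : 0 < h) (hT : t + h + h ≤ T) {e : ℝ → ℝ≥0∞}
    (he : Tendsto e atTop (𝓝 0))
    (hMe : ∀ n K, 0 ≤ K → ∫⁻ ω, ENNReal.ofReal (|Mn n ω T| - K) ∂(Pn n) ≤ e K)
    (S : Finset (Set.Iic s)) (g : BoundedContinuousFunction (S → (Fin k → ℝ) × ℝ) ℝ) :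
    (∀ K, 0 ≤ K → ∫⁻ ω, ENNReal.ofReal (|avg (t + h) h (M ω)| - K) ∂P ≤ e K) ∧
    ∫ ω, avg (t + h) h (M ω) * g (fun j => avgPair j h ((X ω).snoc (M ω))) ∂P =
      ∫ ω, avg (s + h) h (M ω) * g (fun j => avgPair j h ((X ω).snoc (M ω))) ∂P := by
  have hZn : ∀ n, Measurable[filtrationOfPair (Xn n) (Mn n) (hXn n) (hMn n) (s + h)]
      fun ω => g (fun j => avgPair j h ((Xn n ω).snoc (Mn n ω))) := fun n =>
    measurable_comp_avgPair (fun j u hu => measurable_evalPair_snoc (hXn n) (hMn n)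
      (hu.trans (add_le_add j.1.2 le_rfl))) g.continuous.measurable
  have hZ : Measurable fun ω => g (fun j => avgPair j h ((X ω).snoc (M ω))) :=
    measurable_comp_avgPair (fun j u _ => (measurable_evalPair_snoc hX hM le_rfl).mono
      ((filtrationOfPair X M hX hM).le u) le_rfl) g.continuous.measurable
  -- `M_n(u)` is a conditional expectation of `M_n(T)`, so control at the single time `T` suffices.
  have hcond : ∀ n, ∀ u ≤ T, ∀ K, 0 ≤ K →
      ∫⁻ ω, ENNReal.ofReal (|Mn n ω u| - K) ∂(Pn n) ≤ e K := by
    intro n u hu K hK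
    refine le_trans (le_of_eq (lintegral_congr_ae ?_)) ((lintegral_excess_condExp_le
      ((filtrationOfPair (Xn n) (Mn n) (hXn n) (hMn n)).le u)
      ((hmart n).integrable T) K).trans (hMe n K hK))
    filter_upwards [(hmart n).2 u T hu] with ω hω
    rw [hω]
  have key : ∀ v, v ≤ t →
      (∀ K, 0 ≤ K → ∫⁻ ω, ENNReal.ofReal (|avg (v + h) h (M ω)| - K) ∂P ≤ e K) ∧
      Integrable (fun ω => avg (v + h) h (M ω)) P ∧
      Tendsto (fun n => ∫ ω, avg (v + h) h (Mn n ω) *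
        g (fun j => avgPair j h ((Xn n ω).snoc (Mn n ω))) ∂(Pn n)) atTop
        (𝓝 (∫ ω, avg (v + h) h (M ω) * g (fun j => avgPair j h ((X ω).snoc (M ω))) ∂P)) := by
    intro v hv
    refine tendsto_integral_mul_of_uniformIntegrable
      (fun n => measurable_avg _ _ fun u _ => (measurable_eval u).comp (hMn n))
      (fun n => (hZn n).mono (Filtration.le _ _) le_rfl)
      (measurable_avg _ _ fun u _ => (measurable_eval u).comp hM) hZ (norm_nonneg g)
      (fun n ω => g.norm_coe_le_norm _) (fun ω => g.norm_coe_le_norm _) (fun f => ?_) he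
      (fun n K hK => lintegral_excess_avg_le (hMn n) fun u hu => hcond n u ?_ K hK)
    · have hc : Continuous fun w : Dpow (k + 1) =>
          (avg (v + h) h (w (Fin.last k)), g (fun j : S => avgPair j h w)) :=
        ((continuous_avg _ hh).comp (Dpow.continuous_apply _)).prodMk
          (g.continuous.comp (continuous_pi fun j => continuous_avgPair _ hh))
      simpa only [BoundedContinuousFunction.compContinuous_apply, ContinuousMap.coe_mk,
        Dpow.snoc_last] using hconv.tendsto_integral (f.compContinuous ⟨_, hc⟩)
    · exact hu.trans ((add_le_add (add_le_add hv le_rfl) le_rfl).trans hT)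
  obtain ⟨h1, -, h3⟩ := key t le_rfl
  obtain ⟨-, -, h4⟩ := key s hst
  refine ⟨h1, tendsto_nhds_unique h3 (h4.congr fun n => ?_)⟩
  -- Both sides equal `E[M_n(s + h) Z_n]`.
  rw [integral_avg_mul (hMn n) (hmart n) le_rfl (hZn n) (fun ω => g.norm_coe_le_norm _),
    integral_avg_mul (hMn n) (hmart n) (add_le_add hst le_rfl) (hZn n)
      (fun ω => g.norm_coe_le_norm _)]

/-- The limit `h → 0`. The averages converge pointwise to values of the paths, and the excess bound,
uniform in `h`, gives convergence of the expectations and integrability of `M(t)`. -/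
lemma integral_mul_eq_of_limit
    (hXn : ∀ n, Measurable (Xn n)) (hMn : ∀ n, Measurable (Mn n))
    (hX : Measurable X) (hM : Measurable M)
    (hmart : ∀ n, Martingale (fun (t : ℝ≥0) (ω : Ωn n) => Mn n ω t)
      (filtrationOfPair (Xn n) (Mn n) (hXn n) (hMn n)) (Pn n))
    (hconv : TendstoInDistribution (fun n (ω : Ωn n) => (Xn n ω).snoc (Mn n ω)) atTop
      (fun ω : Ω => (X ω).snoc (M ω)) Pn P)
    (hUI : ∀ t : ℝ≥0, 0 < t → UnifInt Pn (fun n ω => Mn n ω t))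
    {s t : ℝ≥0} (hst : s ≤ t)
    (S : Finset (Set.Iic s)) (g : BoundedContinuousFunction (S → (Fin k → ℝ) × ℝ) ℝ) :
    Integrable (fun ω => M ω t) P ∧
    ∫ ω, M ω t * g (fun j => evalPair j ((X ω).snoc (M ω))) ∂P =
      ∫ ω, M ω s * g (fun j => evalPair j ((X ω).snoc (M ω))) ∂P := by
  -- Since `h ≤ 1`, the time `t + 2` lies beyond every averaging interval; it is positive even for
  -- `t = 0`, where uniform integrability is not assumed.
  set e : ℝ → ℝ≥0∞ := fun K =>
    ⨆ n, ∫⁻ ω in {ω | K ≤ |Mn n ω (t + 2)|}, ENNReal.ofReal |Mn n ω (t + 2)| ∂(Pn n)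
  have he : Tendsto e atTop (𝓝 0) := hUI (t + 2) (by positivity)
  have hMe : ∀ n K, 0 ≤ K → ∫⁻ ω, ENNReal.ofReal (|Mn n ω (t + 2)| - K) ∂(Pn n) ≤ e K :=
    fun n K hK => lintegral_excess_le_iSup (P := Pn) (f := fun n ω => Mn n ω (t + 2))
      (fun n => (measurable_eval _).comp (hMn n)) n hK
  let h : ℕ → ℝ≥0 := fun n => 1 / ((n : ℝ≥0) + 1)
  have hh : ∀ n, 0 < h n := fun n => by positivity
  have hh1 : ∀ n, h n ≤ 1 := fun n => by
    rw [div_le_one (by positivity)]; exact le_add_self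
  have hh0 : Tendsto h atTop (𝓝 0) := tendsto_one_div_add_atTop_nhds_zero_nat
  have hT : ∀ n, ∀ v ≤ t, v + h n + h n ≤ t + 2 := fun n v hv => by
    rw [add_assoc, ← one_add_one_eq_two]
    exact add_le_add hv (add_le_add (hh1 n) (hh1 n))
  have hW : ∀ u, Measurable fun ω => evalPair u ((X ω).snoc (M ω)) := fun u =>
    (measurable_evalPair_snoc hX hM le_rfl).mono ((filtrationOfPair X M hX hM).le u) le_rfl
  have key : ∀ v, s ≤ v → v ≤ t → Integrable (fun ω => M ω v) P ∧
      Tendsto (fun n => ∫ ω, avg (v + h n) (h n) (M ω) *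
        g (fun j => avgPair j (h n) ((X ω).snoc (M ω))) ∂P) atTop
        (𝓝 (∫ ω, M ω v * g (fun j => evalPair j ((X ω).snoc (M ω))) ∂P)) := by
    intro v hsv hv
    have hA : ∀ n, Measurable fun ω => avg (v + h n) (h n) (M ω) := fun n =>
      measurable_avg _ _ fun u _ => (measurable_eval u).comp hM
    have hZ : ∀ n, Measurable fun ω => g (fun j : S => avgPair j (h n) ((X ω).snoc (M ω))) :=
      fun n => measurable_comp_avgPair (fun _ u _ => hW u) g.continuous.measurable
    -- The same convergence theorem, now along `h n → 0` on the fixed space of `P`: convergence in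
    -- distribution of the pairs follows from pointwise convergence.
    refine (tendsto_integral_mul_of_uniformIntegrable (Pn := fun _ => P) hA hZ
      ((measurable_eval v).comp hM)
      (g.continuous.measurable.comp (measurable_pi_lambda _ fun j => hW j)) (norm_nonneg g)
      (fun n ω => g.norm_coe_le_norm _) (fun ω => g.norm_coe_le_norm _) (fun f => ?_) he
      (fun n => (limit_avg hXn hMn hX hM hmart hconv hsv (hh n) (hT n v hv) he hMe S g).1)).2
    refine tendsto_integral_of_dominated_convergence (fun _ => ‖f‖)
      (fun n => (f.continuous.measurable.comp ((hA n).prodMk (hZ n))).aestronglyMeasurable)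
      (integrable_const _) (fun n => ae_of_all _ fun ω => f.norm_coe_le_norm _)
      (ae_of_all _ fun ω => ?_)
    refine (f.continuous.tendsto _).comp (Tendsto.prodMk_nhds ?_ ?_)
    · exact tendsto_avg _ _ (fun _ => le_self_add) (by simpa using hh0.const_add v) hh0
    · exact (g.continuous.tendsto _).comp
        (tendsto_pi_nhds.2 fun j => tendsto_avgPair _ _ hh0)
  obtain ⟨h1, h2⟩ := key t hst le_rfl
  obtain ⟨-, h3⟩ := key s le_rfl hst
  refine ⟨h1, tendsto_nhds_unique h2 (h3.congr fun n => ?_)⟩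
  exact (limit_avg hXn hMn hX hM hmart hconv hst (hh n) (hT n t le_rfl) he hMe S g).2.symm

end Limit

end Skorokhod

/-! ### The martingale property of the limit -/

theorem theorem5p3 {k : ℕ}
    {Ωn : ℕ → Type*} [∀ n, MeasurableSpace (Ωn n)]
    (Pn : ∀ n, Measure (Ωn n)) [∀ n, IsProbabilityMeasure (Pn n)]
    {Ω : Type*} [MeasurableSpace Ω] (P : Measure Ω) [IsProbabilityMeasure P]
    (Xn : ∀ n, Ωn n → Skorokhod.Dpow k) (Mn : ∀ n, Ωn n → Skorokhod.D)
    (X : Ω → Skorokhod.Dpow k) (M : Ω → Skorokhod.D)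
    (hXn : ∀ n, Measurable (Xn n)) (hMn : ∀ n, Measurable (Mn n))
    (hX : Measurable X) (hM : Measurable M)
    (hmart : ∀ n, Martingale (fun (t : ℝ≥0) (ω : Ωn n) => Mn n ω t)
      (Skorokhod.filtrationOfPair (Xn n) (Mn n) (hXn n) (hMn n)) (Pn n))
    (hconv : TendstoInDistribution
      (fun n (ω : Ωn n) => Skorokhod.Dpow.snoc (Xn n ω) (Mn n ω)) atTop
      (fun ω : Ω => Skorokhod.Dpow.snoc (X ω) (M ω)) Pn P)
    (hUI : ∀ t : ℝ≥0, 0 < t → Skorokhod.UnifInt Pn (fun n ω => Mn n ω t)) :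
    Martingale (fun (t : ℝ≥0) (ω : Ω) => M ω t)
      (Skorokhod.filtrationOfPair X M hX hM) P ∧
    Martingale (fun (t : ℝ≥0) (ω : Ω) => M ω t)
      (Skorokhod.filtrationOf M hM) P := by
  have hlim := fun {s t : ℝ≥0} (hst : s ≤ t) =>
    Skorokhod.integral_mul_eq_of_limit hXn hMn hX hM hmart hconv hUI hst
  have hint : ∀ t, Integrable (fun ω => M ω t) P := fun t => (hlim (le_refl t) ∅ 0).1
  have hMm : ∀ t, Measurable fun ω => M ω t := fun t => (Skorokhod.measurable_eval t).comp hM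
  have hpair : Martingale (fun (t : ℝ≥0) (ω : Ω) => M ω t)
      (Skorokhod.filtrationOfPair X M hX hM) P := by
    refine martingale_of_setIntegral_eq
      (fun t => (Skorokhod.measurable_eval_filtrationOfPair hX hM le_rfl).stronglyMeasurable)
      hint fun s t hst A hA => ?_
    rw [eq_comm, ← sub_eq_zero, ← integral_sub (hint t).integrableOn (hint s).integrableOn]
    -- The past up to `s` is generated by the single map sending `ω` to the family of all values at
    -- times in `Set.Iic s`, so finite sets of times suffice to test its events.
    rw [Skorokhod.filtrationOfPair, Filtration.natural_eq_comap] at hA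
    refine setIntegral_eq_zero_of_forall_finset
      (Y := fun (j : Set.Iic s) ω => ((fun i => X ω i j : Fin k → ℝ), M ω j))
      (fun j => (measurable_pi_lambda _ fun i => (Skorokhod.measurable_eval j).comp
        ((Skorokhod.measurable_proj i).comp hX)).prodMk (hMm j))
      ((hint t).sub (hint s)) ((hMm t).sub (hMm s)) (fun S g => ?_) hA
    have hg : Measurable fun ω => g (fun j : S => Skorokhod.evalPair j ((X ω).snoc (M ω))) :=
      g.continuous.measurable.comp (measurable_pi_lambda _ fun j =>
        (Skorokhod.measurable_evalPair_snoc hX hM le_rfl).mono (Filtration.le _ _) le_rfl)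
    have hmul : ∀ u, Integrable
        (fun ω => M ω u * g (fun j : S => Skorokhod.evalPair j ((X ω).snoc (M ω)))) P := fun u =>
      (hint u).mul_bdd (c := ‖g‖) hg.aestronglyMeasurable
        (ae_of_all _ fun ω => g.norm_coe_le_norm _)
    have h0 := sub_eq_zero.2 (hlim hst S g).2
    rw [← integral_sub (hmul t) (hmul s)] at h0
    simpa only [Pi.sub_apply, sub_mul, Skorokhod.evalPair_snoc] using h0
  -- Every event of the past of `M` is an event of the past of `(X, M)`.
  refine ⟨hpair, martingale_of_setIntegral_eq (Filtration.stronglyAdapted_natural _) hint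
    fun s t hst A hA => hpair.setIntegral_eq hst
      (Skorokhod.filtrationOf_le_filtrationOfPair hX hM s A hA)⟩
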